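/- Let $N\ge 4$, let $P_N$ be the path with $N$ vertices $1,\dots,N$ (with $j$ adjacent to $j+1$ for $1\le j<N$), and let $A$ be its adjacency matrix. Let $Q=\mathrm{diag}(Q_1,\dots,Q_N)$ be any real diagonal matrix (a potential, not assumed to be symmetric), and let $H=A-Q$. For two vertices $u,v$, there is perfect state transfer from $u$ to $v$ if there is a time $T\in\mathbb{R}$ at which the solution of $\frac{d}{dt}\varphi_t=iH\varphi_t$ with $\varphi_0=\mathbf 1_u$ satisfies $|\varphi_T(v)|=1$ and $\varphi_T(x)=0$ for all $x\ne v$. Theorem. There is no perfect state transfer between the two endpoints of $P_N$: there is none from $1$ to $N$ and none from $N$ to $1$, for any real potential $Q$ and at any time $T$. -/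

import Mathlib

open Classical in
/-- The Hamiltonian `H = A - Q` of a graph `G` with a real potential `Q` on its vertices: `A` is
the adjacency matrix of `G`, and `Q` is regarded as a diagonal matrix. -/
noncomputable def hamiltonian {V : Type*} [DecidableEq V] (G : SimpleGraph V)
    (Q : V → ℝ) : Matrix V V ℝ :=
  G.adjMatrix ℝ - Matrix.diagonal Q

/-- `φ` is a solution, on the whole time axis, of the discrete Schrödinger equation
`dφ_t/dt = i H φ_t`. -/
def IsSchrodingerSolution {V : Type*} [Fintype V] (H : Matrix V V ℝ) (φ : ℝ → V → ℂ) : Prop :=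
  ∀ t : ℝ, HasDerivAt φ (Complex.I • Matrix.mulVec (H.map Complex.ofReal) (φ t)) t

/-- Perfect state transfer from `u` to `v` at time `T`: the solution of the Schrödinger equation
that starts in the characteristic function of `u` is concentrated on `v` at time `T`. (The solution
exists and is unique, the equation being linear with constant coefficients.) -/
def PerfectStateTransferAt {V : Type*} [Fintype V] [DecidableEq V] (H : Matrix V V ℝ)
    (u v : V) (T : ℝ) : Prop :=
  ∃ φ : ℝ → V → ℂ, IsSchrodingerSolution H φ ∧ φ 0 = Pi.single u 1 ∧
    ‖φ T v‖ = 1 ∧ ∀ x : V, x ≠ v → φ T x = 0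

/-- There is perfect state transfer from `u` to `v` at some time. -/
def PerfectStateTransfer {V : Type*} [Fintype V] [DecidableEq V] (H : Matrix V V ℝ)
    (u v : V) : Prop :=
  ∃ T : ℝ, PerfectStateTransferAt H u v T

/-! Let p_k be the polynomials with p_k(H)e_1 = e_k (`jacobiPoly`). If e_1 evolves to γe_N,
conservation of p_k(H) H p_k(H) forces the diagonal to be mirror-symmetric (`diag_mirror`). Then
every root of p_{N+1} arising from a symmetric or antisymmetric middle condition has p_N = ±1, and
the phase condition exp(ixT) = ±γ places the two classes of eigenvalues at odd and even points of
one lattice ω + cℤ, c = π/T.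

The two half-length factors have resultant of absolute value a power of 2, so a power of |c| times
an odd integer is a power of 2. Comparing their top coefficients gives cD = 2 (N even) or c²D = 4 (N
odd) with D an integer. Eliminating c leaves an equation of 2-adic valuations that has no solution
for N ≥ 4 (`even_spectrum_false`, `odd_spectrum_false`). -/

open Polynomial

/-! ### Roots, top coefficients and resultants -/

theorem Multiset.two_mul_esymm_two {R : Type*} [CommRing R] (s : Multiset R) :
    2 * s.esymm 2 = s.sum ^ 2 - (s.map (· ^ 2)).sum := by
  induction s using Multiset.induction with
  | empty => simp [Multiset.esymm, Multiset.powersetCard_zero_right]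
  | cons a s ih =>
    have h : (a ::ₘ s).esymm 2 = s.esymm 2 + a * s.sum := by
      simp [Multiset.esymm, Multiset.powersetCard_cons, Multiset.powersetCard_one]
      simpa using Multiset.sum_map_mul_left (s := s) (a := a) (f := id)
    rw [h, Multiset.sum_cons, Multiset.map_cons, Multiset.sum_cons]
    linear_combination ih

/-- Used to replace a multiset of eigenvalues by integer lattice indices, keeping multiplicities. -/
theorem Multiset.exists_map_eq {α β : Type*} {f : α → β} {s : Multiset β}
    (h : ∀ x ∈ s, ∃ y, f y = x) : ∃ t : Multiset α, t.map f = s := by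
  induction s using Multiset.induction with
  | empty => exact ⟨0, rfl⟩
  | cons a s ih =>
    obtain ⟨t, ht⟩ := ih fun x hx => h x (Multiset.mem_cons_of_mem hx)
    obtain ⟨y, hy⟩ := h a (Multiset.mem_cons_self a s)
    exact ⟨y ::ₘ t, by simp [ht, hy]⟩

theorem Polynomial.coeff_eq_neg_sum_roots {f : ℂ[X]} (hf : f.Monic) {n : ℕ}
    (hn : f.natDegree = n + 1) : f.coeff n = -f.roots.sum := by
  rw [← (IsAlgClosed.splits f).nextCoeff_eq_neg_sum_roots_of_monic hf,
    nextCoeff_of_natDegree_pos (by omega), hn]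
  rfl

theorem Polynomial.two_mul_coeff_eq_sum_roots {f : ℂ[X]} (hf : f.Monic) {n : ℕ}
    (hn : f.natDegree = n + 2) :
    2 * f.coeff n = f.roots.sum ^ 2 - (f.roots.map (· ^ 2)).sum := by
  rw [← Multiset.two_mul_esymm_two,
    coeff_eq_esymm_roots_of_splits (IsAlgClosed.splits f) (by omega), hf.leadingCoeff, hn]
  simp

theorem Polynomial.norm_eval_eq_prod_roots {p : ℂ[X]} (hp : p.Monic) (x : ℂ) :
    ‖p.eval x‖ = (p.roots.map fun b => ‖x - b‖).prod := by
  rw [(IsAlgClosed.splits p).eval_eq_prod_roots_of_monic hp]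
  generalize p.roots = s
  induction s using Multiset.induction with
  | empty => simp
  | cons a s ih => simp [ih]

/-- The absolute value of the resultant of two monic polynomials is symmetric. -/
theorem Polynomial.prod_norm_eval_roots_comm {f g : ℂ[X]} (hf : f.Monic) (hg : g.Monic) :
    (f.roots.map fun a => ‖g.eval a‖).prod = (g.roots.map fun b => ‖f.eval b‖).prod := by
  simp only [norm_eval_eq_prod_roots hf, norm_eval_eq_prod_roots hg]
  rw [Multiset.prod_map_prod_map]
  simp only [norm_sub_rev]

/-! ### Orthogonal polynomials and the two half-length factors -/

/-- The monic orthogonal polynomials of the Jacobi matrix with diagonal `d 1, d 2, …` and all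
off-diagonal entries equal to `1`, with the index shifted by one. -/
noncomputable def jacobiPoly (d : ℕ → ℂ) : ℕ → ℂ[X]
  | 0 => 0
  | 1 => 1
  | n + 2 => (X - C (d (n + 1))) * jacobiPoly d (n + 1) - jacobiPoly d n

namespace jacobiPoly

variable (d : ℕ → ℂ)

theorem rec_eq (n : ℕ) : jacobiPoly d (n + 2) =
    (X - C (d (n + 1))) * jacobiPoly d (n + 1) - jacobiPoly d n := rfl

theorem monic_and_degree (n : ℕ) : (jacobiPoly d (n + 1)).Monic ∧
    (jacobiPoly d (n + 1)).degree = n ∧ (jacobiPoly d n).degree < n := by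
  induction n with
  | zero => simp [jacobiPoly]
  | succ n ih =>
    obtain ⟨h1, h2, h3⟩ := ih
    have hm : ((X - C (d (n + 1))) * jacobiPoly d (n + 1)).Monic := (monic_X_sub_C _).mul h1
    have hd : ((X - C (d (n + 1))) * jacobiPoly d (n + 1)).degree = ((n + 1 : ℕ) : WithBot ℕ) := by
      rw [degree_mul, degree_X_sub_C, h2]; push_cast; exact add_comm _ _
    have hlt : (jacobiPoly d n).degree < ((X - C (d (n + 1))) * jacobiPoly d (n + 1)).degree := by
      rw [hd]; exact h3.trans (by exact_mod_cast Nat.lt_succ_self n)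
    refine ⟨hm.sub_of_left hlt, ?_, ?_⟩
    · rw [rec_eq, degree_sub_eq_left_of_degree_lt hlt, hd]
    · rw [h2]; exact_mod_cast Nat.lt_succ_self n

theorem monic (n : ℕ) : (jacobiPoly d (n + 1)).Monic := (monic_and_degree d n).1

theorem degree (n : ℕ) : (jacobiPoly d (n + 1)).degree = n := (monic_and_degree d n).2.1

theorem natDegree (n : ℕ) : (jacobiPoly d (n + 1)).natDegree = n :=
  natDegree_eq_of_degree_eq_some (degree d n)

theorem coeff_eq_zero {n k : ℕ} (h : n ≤ k) : (jacobiPoly d n).coeff k = 0 :=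
  coeff_eq_zero_of_degree_lt ((monic_and_degree d n).2.2.trans_le (by exact_mod_cast h))

/-- Consecutive orthogonal polynomials have resultant `±1`. -/
theorem prod_norm_eval_roots (n : ℕ) :
    ((jacobiPoly d (n + 1)).roots.map fun b => ‖(jacobiPoly d n).eval b‖).prod = 1 := by
  induction n with
  | zero => simp [jacobiPoly]
  | succ n ih =>
    -- After the swap the product runs over roots of the lower polynomial, where the recurrence
    -- reduces the higher one to minus its predecessor.
    rw [prod_norm_eval_roots_comm (monic d _) (monic d _), ← ih]
    refine congrArg _ (Multiset.map_congr rfl fun b hb => ?_)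
    have : (jacobiPoly d (n + 1)).eval b = 0 := by
      simpa using (mem_roots'.1 hb).2
    simp [rec_eq, this]

theorem monic_sub_C_mul (n : ℕ) (c : ℂ) : (jacobiPoly d (n + 2) - C c * jacobiPoly d (n + 1)).Monic ∧
    (jacobiPoly d (n + 2) - C c * jacobiPoly d (n + 1)).natDegree = n + 1 := by
  have hlt : (C c * jacobiPoly d (n + 1)).degree < (jacobiPoly d (n + 2)).degree := by
    rw [degree d (n + 1)]
    refine ((degree_mul_le _ _).trans (add_le_of_nonpos_left degree_C_le)).trans_lt ?_
    rw [degree]; exact_mod_cast Nat.lt_succ_self n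
  refine ⟨(monic d (n + 1)).sub_of_left hlt, natDegree_eq_of_degree_eq_some ?_⟩
  rw [degree_sub_eq_left_of_degree_lt hlt, degree]

/-- The factors of the characteristic polynomial of a mirror-symmetric path of even order. -/
theorem even_factors (n : ℕ) {p q : ℂ[X]} (hp : p = jacobiPoly d (n + 2) - jacobiPoly d (n + 1))
    (hq : q = jacobiPoly d (n + 2) + jacobiPoly d (n + 1)) :
    p.roots.card = n + 1 ∧ q.roots.card = n + 1 ∧ p.roots.sum - q.roots.sum = 2 ∧
    (p.roots.map fun a => (q.roots.map fun b => ‖a - b‖).prod).prod = 2 ^ (n + 1) := by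
  have hp' : p.Monic ∧ p.natDegree = n + 1 := by
    simpa [hp] using monic_sub_C_mul d n 1
  have hq' : q.Monic ∧ q.natDegree = n + 1 := by
    simpa [hq] using monic_sub_C_mul d n (-1)
  have hcp : p.roots.card = n + 1 := (IsAlgClosed.splits p).natDegree_eq_card_roots.symm.trans hp'.2
  have hcq : q.roots.card = n + 1 := (IsAlgClosed.splits q).natDegree_eq_card_roots.symm.trans hq'.2
  refine ⟨hcp, hcq, ?_, ?_⟩
  · have h1 := coeff_eq_neg_sum_roots hp'.1 hp'.2
    have h2 := coeff_eq_neg_sum_roots hq'.1 hq'.2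
    have h3 : (jacobiPoly d (n + 1)).coeff n = 1 := by
      have := (monic d n).coeff_natDegree
      rwa [natDegree] at this
    have h4 : q.coeff n - p.coeff n = 2 := by
      rw [hp, hq, coeff_add, coeff_sub, h3]; ring
    linear_combination h4 + h1 - h2
  -- Each root of `p` contributes a factor 2; what remains is, up to sign, the resultant of
  -- consecutive orthogonal polynomials.
  · have h1 : ∀ a ∈ p.roots, ‖q.eval a‖ = 2 * ‖(jacobiPoly d (n + 1)).eval a‖ := by
      intro a ha
      have h0 : p.eval a = 0 := (mem_roots'.1 ha).2
      have h2 : q.eval a = 2 * (jacobiPoly d (n + 1)).eval a := by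
        rw [hp, eval_sub] at h0
        rw [hq, eval_add]
        linear_combination h0
      rw [h2, norm_mul, Complex.norm_ofNat]
    have h2 : ∀ b ∈ (jacobiPoly d (n + 1)).roots, ‖p.eval b‖ = ‖(jacobiPoly d n).eval b‖ := by
      intro b hb
      have : (jacobiPoly d (n + 1)).eval b = 0 := (mem_roots'.1 hb).2
      simp [hp, rec_eq, this]
    simp only [← norm_eval_eq_prod_roots hq'.1]
    rw [Multiset.map_congr rfl h1, Multiset.prod_map_mul, prod_norm_eval_roots_comm hp'.1 (monic d n),
      Multiset.map_congr rfl h2, prod_norm_eval_roots]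
    simp [hcp, pow_succ']

/-- The factors of the characteristic polynomial of a mirror-symmetric path of odd order. -/
theorem odd_factors (n : ℕ) {p q : ℂ[X]} (hp : p = jacobiPoly d (n + 3))
    (hq : q = jacobiPoly d (n + 4) - jacobiPoly d (n + 2)) :
    p.roots.card = n + 2 ∧ q.roots.card = n + 3 ∧
    (q.roots.map (· ^ 2)).sum - (p.roots.map (· ^ 2)).sum - (q.roots.sum - p.roots.sum) ^ 2 = 4 ∧
    (p.roots.map fun a => (q.roots.map fun b => ‖a - b‖).prod).prod = 2 ^ (n + 2) := by
  have hpm : p.Monic := hp ▸ monic d (n + 2)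
  have hpd : p.natDegree = n + 2 := hp ▸ natDegree d (n + 2)
  have hlt : (jacobiPoly d (n + 2)).degree < (jacobiPoly d (n + 4)).degree := by
    rw [degree d (n + 3), degree d (n + 1)]; exact_mod_cast (by omega : n + 1 < n + 3)
  have hqm : q.Monic := hq ▸ (monic d (n + 3)).sub_of_left hlt
  have hqd : q.natDegree = n + 3 := by
    refine natDegree_eq_of_degree_eq_some ?_
    rw [hq, degree_sub_eq_left_of_degree_lt hlt, degree]
  have hcp : p.roots.card = n + 2 := (IsAlgClosed.splits p).natDegree_eq_card_roots.symm.trans hpd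
  have hcq : q.roots.card = n + 3 := (IsAlgClosed.splits q).natDegree_eq_card_roots.symm.trans hqd
  -- The recurrence at the middle vertex, whose diagonal entry is `d (n + 3)`.
  have hq' : q = X * p - C (d (n + 3)) * p - C 2 * jacobiPoly d (n + 2) := by
    rw [hq, hp, rec_eq d (n + 2), C_ofNat]; ring
  refine ⟨hcp, hcq, ?_, ?_⟩
  · have h1 := coeff_eq_neg_sum_roots hpm hpd
    have h2 := coeff_eq_neg_sum_roots hqm hqd
    have h3 := two_mul_coeff_eq_sum_roots hpm hpd
    have h4 := two_mul_coeff_eq_sum_roots hqm hqd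
    have h5 : (jacobiPoly d (n + 2)).coeff (n + 1) = 1 := by
      have := (monic d (n + 1)).coeff_natDegree
      rwa [natDegree] at this
    have h6 : p.coeff (n + 2) = 1 := by
      rw [← hpd]; exact hpm.coeff_natDegree
    have h7 : q.coeff (n + 1) = p.coeff n - d (n + 3) * p.coeff (n + 1) - 2 := by
      rw [hq', coeff_sub, coeff_sub, coeff_X_mul, coeff_C_mul, coeff_C_mul, h5, mul_one]
    have h8 : q.coeff (n + 2) = p.coeff (n + 1) - d (n + 3) := by
      rw [hq', coeff_sub, coeff_sub, coeff_X_mul, coeff_C_mul, coeff_C_mul, h6,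
        coeff_eq_zero d le_rfl]
      ring
    have e1 : q.roots.sum = p.roots.sum + d (n + 3) := by
      linear_combination h2 - h1 - h8
    rw [e1] at h4 ⊢
    linear_combination h4 - h3 - 2 * h7 + 2 * d (n + 3) * h1
  · have h1 : ∀ a ∈ p.roots, ‖q.eval a‖ = 2 * ‖(jacobiPoly d (n + 2)).eval a‖ := by
      intro a ha
      have h0 : p.eval a = 0 := (mem_roots'.1 ha).2
      simp [hq', h0]
    simp only [← norm_eval_eq_prod_roots hqm]
    rw [Multiset.map_congr rfl h1, Multiset.prod_map_mul]
    have := prod_norm_eval_roots d (n + 2)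
    rw [← hp] at this
    rw [this]
    simp [hcp, pow_succ']

/-- A solution of the three-term recurrence with mirror-symmetric coefficients that is symmetric or
antisymmetric at two consecutive places is so everywhere. -/
theorem eval_mirror {s : ℕ} (hd : ∀ k, 1 ≤ k → k < s → d (s - k) = d k) (x ε : ℂ) {m : ℕ}
    (hm : m + 1 ≤ s)
    (h0 : (jacobiPoly d (s - m)).eval x = ε * (jacobiPoly d m).eval x)
    (h1 : (jacobiPoly d (s - (m + 1))).eval x = ε * (jacobiPoly d (m + 1)).eval x) :
    (jacobiPoly d s).eval x = 0 ∧ (1 ≤ m → (jacobiPoly d (s - 1)).eval x = ε) := by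
  induction m with
  | zero =>
    refine ⟨by simpa [jacobiPoly] using h0, by simp⟩
  | succ m ih =>
    obtain ⟨t, rfl⟩ : ∃ t, s = m + 2 + t := ⟨s - (m + 2), by omega⟩
    have e0 : m + 2 + t - m = t + 2 := by omega
    have e1 : m + 2 + t - (m + 1) = t + 1 := by omega
    have e2 : m + 2 + t - (m + 1 + 1) = t := by omega
    have hd' := hd (m + 1) (by omega) (by omega)
    rw [e1] at h0 hd'
    rw [e2] at h1
    -- The recurrence is run outwards from the middle: up on one side and down on the other, with
    -- equal diagonal entries.
    have key : (jacobiPoly d (m + 2 + t - m)).eval x = ε * (jacobiPoly d m).eval x := by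
      rw [e0, rec_eq, eval_sub, eval_mul, h0, h1, rec_eq, hd']
      simp only [eval_sub, eval_mul, eval_X, eval_C]
      ring
    have h0' : (jacobiPoly d (m + 2 + t - (m + 1))).eval x = ε * (jacobiPoly d (m + 1)).eval x := by
      rw [e1, h0]
    refine ⟨(ih (by omega) key h0').1, fun _ => ?_⟩
    rcases m.eq_zero_or_pos with rfl | h
    · simpa [jacobiPoly] using h0'
    · exact (ih (by omega) key h0').2 h

end jacobiPoly

/-! ### 2-adic obstruction for lattice spectra -/

theorem Multiset.exists_odd_prod_norm (c : ℂ) (A B : Multiset ℤ)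
    (h : ∀ a ∈ A, ∀ b ∈ B, Odd (a - b)) : ∃ o : ℕ, Odd o ∧
    (A.map fun a => (B.map fun b => ‖c * (a - b : ℤ)‖).prod).prod =
      ‖c‖ ^ (A.card * B.card) * o := by
  have row : ∀ a : ℤ, (∀ b ∈ B, Odd (a - b)) → ∃ o : ℕ, Odd o ∧
      (B.map fun b => ‖c * (a - b : ℤ)‖).prod = ‖c‖ ^ B.card * o := by
    intro a ha
    clear h
    induction B using Multiset.induction with
    | empty => exact ⟨1, odd_one, by simp⟩
    | cons b B ih =>
      obtain ⟨o, ho, e⟩ := ih fun b hb => ha b (Multiset.mem_cons_of_mem hb)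
      refine ⟨(a - b).natAbs * o, (Int.natAbs_odd.2 (ha b (Multiset.mem_cons_self b B))).mul ho, ?_⟩
      rw [Multiset.map_cons, Multiset.prod_cons, e, norm_mul, Complex.norm_intCast,
        Multiset.card_cons, Nat.cast_mul, Nat.cast_natAbs, Int.cast_abs]
      ring
  induction A using Multiset.induction with
  | empty => exact ⟨1, odd_one, by simp⟩
  | cons a A ih =>
    obtain ⟨o, ho, e⟩ := ih fun b hb => h b (Multiset.mem_cons_of_mem hb)
    obtain ⟨o', ho', e'⟩ := row a (h a (Multiset.mem_cons_self a A))
    refine ⟨o' * o, ho'.mul ho, ?_⟩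
    rw [Multiset.map_cons, Multiset.prod_cons, e, e', Multiset.card_cons]
    push_cast
    ring

theorem factorization_two_of_pow_eq {r s i : ℕ} {K o : ℕ} (ho : Odd o)
    (h : 2 ^ r * o = 2 ^ s * K ^ i) : r = s + i * K.factorization 2 := by
  have h2 : o.factorization 2 = 0 := Nat.factorization_eq_zero_of_not_dvd ho.not_two_dvd_nat
  have ho0 : o ≠ 0 := ho.pos.ne'
  have hK : K ^ i ≠ 0 := by
    rintro h0
    rw [h0] at h
    simp [ho0] at h
  have := congrArg (fun n => n.factorization 2) h
  simp only [Nat.factorization_mul (pow_ne_zero r two_ne_zero) ho0,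
    Nat.factorization_mul (pow_ne_zero s two_ne_zero) hK, Nat.factorization_pow, Finsupp.add_apply,
    Finsupp.smul_apply, h2, Nat.prime_two.factorization_self, smul_eq_mul] at this
  simpa using this

theorem Multiset.sum_map_affine (S : Multiset ℤ) (f : ℤ → ℤ) (c ω : ℂ) :
    (S.map fun k => ω + c * ((f k : ℤ) : ℂ)).sum = S.card * ω + c * ((S.map f).sum : ℤ) := by
  induction S using Multiset.induction with
  | empty => simp
  | cons a S ih =>
    simp only [Multiset.map_cons, Multiset.sum_cons, ih, Multiset.card_cons]
    push_cast
    ring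

theorem Multiset.sum_sq_map_affine (S : Multiset ℤ) (f : ℤ → ℤ) (c ω : ℂ) :
    ((S.map fun k => ω + c * ((f k : ℤ) : ℂ)).map (· ^ 2)).sum = S.card * ω ^ 2 +
      2 * ω * c * ((S.map f).sum : ℤ) + c ^ 2 * (((S.map f).map (· ^ 2)).sum : ℤ) := by
  induction S using Multiset.induction with
  | empty => simp
  | cons a S ih =>
    simp only [Multiset.map_cons, Multiset.sum_cons, ih, Multiset.card_cons]
    push_cast
    ring

/-- Two sets of lattice points of opposite parity cannot be the spectra of the two factors of the
Hamiltonian of a mirror-symmetric path of even order. -/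
theorem even_spectrum_false {m : ℕ} (hm : 2 ≤ m) {c ω : ℂ} {A B : Multiset ℤ}
    (hA : A.card = m) (hB : B.card = m)
    (hs : (A.map fun k : ℤ => ω + c * ((2 * k + 1 : ℤ) : ℂ)).sum -
      (B.map fun k : ℤ => ω + c * ((2 * k : ℤ) : ℂ)).sum = 2)
    (hprod : ((A.map fun k : ℤ => ω + c * ((2 * k + 1 : ℤ) : ℂ)).map fun a =>
      ((B.map fun k : ℤ => ω + c * ((2 * k : ℤ) : ℂ)).map fun b => ‖a - b‖).prod).prod = 2 ^ m) :
    False := by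
  obtain ⟨o, ho, e⟩ := Multiset.exists_odd_prod_norm c (A.map fun k => 2 * k + 1)
    (B.map fun k => 2 * k) (by
      simp only [Multiset.mem_map]
      rintro _ ⟨a, -, rfl⟩ _ ⟨b, -, rfl⟩
      exact ⟨a - b, by ring⟩)
  have e' : ‖c‖ ^ (m * m) * o = 2 ^ m := by
    rw [← hprod, ← hA]
    nth_rw 2 [hA]
    rw [← hB]
    simp only [Multiset.map_map, Multiset.card_map, Function.comp_def] at e ⊢
    rw [← e]
    refine congrArg _ (Multiset.map_congr rfl fun a _ => congrArg _
      (Multiset.map_congr rfl fun b _ => congrArg _ ?_))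
    push_cast; ring
  -- Both multisets have the same size, so `ω` cancels.
  have hD : ∃ D : ℤ, c * D = 2 := by
    refine ⟨(A.map fun k => 2 * k + 1).sum - (B.map fun k => 2 * k).sum, ?_⟩
    rw [Multiset.sum_map_affine A, Multiset.sum_map_affine B, hA, hB] at hs
    push_cast at hs ⊢
    linear_combination hs
  obtain ⟨D, hD⟩ := hD
  have hD' : ‖c‖ * D.natAbs = 2 := by
    have := congrArg norm hD
    rwa [norm_mul, Complex.norm_intCast, Complex.norm_ofNat, ← Int.cast_abs, ← Nat.cast_natAbs] at this
  have key : 2 ^ (m * m) * o = 2 ^ m * D.natAbs ^ (m * m) := by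
    have : (2 : ℝ) ^ (m * m) * o = 2 ^ m * (D.natAbs : ℝ) ^ (m * m) := by
      rw [← e', ← hD']; ring
    exact_mod_cast this
  have := factorization_two_of_pow_eq ho key
  generalize D.natAbs.factorization 2 = v at this
  -- The valuations give m² = m + m²v, impossible for m ≥ 2; m = 1 with v = 0 is a genuine solution.
  rcases v with _ | v <;> nlinarith

/-- Two sets of lattice points of opposite parity cannot be the spectra of the two factors of the
Hamiltonian of a mirror-symmetric path of odd order. -/
theorem odd_spectrum_false {m : ℕ} (hm : 2 ≤ m) {c ω : ℂ} {A B : Multiset ℤ}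
    (hA : A.card = m + 1) (hB : B.card = m)
    (hs : ((A.map fun k : ℤ => ω + c * ((2 * k + 1 : ℤ) : ℂ)).map (· ^ 2)).sum -
      ((B.map fun k : ℤ => ω + c * ((2 * k : ℤ) : ℂ)).map (· ^ 2)).sum -
      ((A.map fun k : ℤ => ω + c * ((2 * k + 1 : ℤ) : ℂ)).sum -
      (B.map fun k : ℤ => ω + c * ((2 * k : ℤ) : ℂ)).sum) ^ 2 = 4)
    (hprod : ((B.map fun k : ℤ => ω + c * ((2 * k : ℤ) : ℂ)).map fun b =>
      ((A.map fun k : ℤ => ω + c * ((2 * k + 1 : ℤ) : ℂ)).map fun a => ‖b - a‖).prod).prod = 2 ^ m) :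
    False := by
  obtain ⟨o, ho, e⟩ := Multiset.exists_odd_prod_norm c (B.map fun k => 2 * k)
    (A.map fun k => 2 * k + 1) (by
      simp only [Multiset.mem_map]
      rintro _ ⟨a, -, rfl⟩ _ ⟨b, -, rfl⟩
      exact ⟨a - b - 1, by ring⟩)
  have e' : ‖c‖ ^ (m * (m + 1)) * o = 2 ^ m := by
    rw [← hprod, ← hA]
    nth_rw 1 [← hB]
    simp only [Multiset.map_map, Multiset.card_map, Function.comp_def] at e ⊢
    rw [← e]
    refine congrArg _ (Multiset.map_congr rfl fun a _ => congrArg _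
      (Multiset.map_congr rfl fun b _ => congrArg _ ?_))
    push_cast; ring
  -- The sizes differ by one, so this combination of first and second moments is translation
  -- invariant and `ω` drops out.
  have hD : ∃ D : ℤ, c ^ 2 * D = 4 := by
    refine ⟨((A.map fun k => 2 * k + 1).map (· ^ 2)).sum - ((B.map fun k => 2 * k).map (· ^ 2)).sum -
      ((A.map fun k => 2 * k + 1).sum - (B.map fun k => 2 * k).sum) ^ 2, ?_⟩
    rw [Multiset.sum_sq_map_affine A, Multiset.sum_sq_map_affine B, Multiset.sum_map_affine A,
      Multiset.sum_map_affine B, hA, hB] at hs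
    push_cast at hs ⊢
    linear_combination hs
  obtain ⟨D, hD⟩ := hD
  have hD' : ‖c‖ ^ 2 * D.natAbs = 4 := by
    have := congrArg norm hD
    rwa [norm_mul, norm_pow, Complex.norm_intCast, Complex.norm_ofNat, ← Int.cast_abs,
      ← Nat.cast_natAbs] at this
  -- Only c² is controlled, so the product relation is squared before c is eliminated.
  have key : 2 ^ (2 * (m * (m + 1))) * o ^ 2 = 2 ^ (2 * m) * D.natAbs ^ (m * (m + 1)) := by
    have : (2 : ℝ) ^ (2 * (m * (m + 1))) * o ^ 2 =
        2 ^ (2 * m) * (D.natAbs : ℝ) ^ (m * (m + 1)) := by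
      rw [pow_mul 2 2, show (2 : ℝ) ^ 2 = 4 by norm_num, ← hD', mul_comm 2 m, pow_mul 2 m, ← e']
      ring
    exact_mod_cast this
  have := factorization_two_of_pow_eq (ho.pow (n := 2)) key
  generalize D.natAbs.factorization 2 = v at this
  have h2 : 2 * m = (m + 1) * v := by
    refine Nat.eq_of_mul_eq_mul_left (show 0 < m by omega) ?_
    linarith
  rcases v with _ | _ | v
  · omega
  · omega
  · nlinarith

/-! ### Conservation laws of the Schrödinger equation -/

section Schrodinger

variable {V : Type*} [Fintype V] {H : Matrix V V ℝ} {φ : ℝ → V → ℂ}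

theorem IsSchrodingerSolution.hasDerivAt_dotProduct (hφ : IsSchrodingerSolution H φ) (v : V → ℂ)
    (t : ℝ) : HasDerivAt (fun t => v ⬝ᵥ φ t)
      (Complex.I * (v ⬝ᵥ Matrix.mulVec (H.map Complex.ofReal) (φ t))) t := by
  have h := hasDerivAt_pi.1 (hφ t)
  rw [← smul_eq_mul, ← dotProduct_smul]
  exact HasDerivAt.fun_sum fun i _ => (h i).const_mul (v i)

/-- The component of a solution along an eigenvector only changes its phase. -/
theorem IsSchrodingerSolution.dotProduct_eigenvector (hφ : IsSchrodingerSolution H φ) {v : V → ℂ}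
    {x : ℂ} (hv : Matrix.vecMul v (H.map Complex.ofReal) = x • v) (t : ℝ) :
    v ⬝ᵥ φ t = Complex.exp (Complex.I * x * t) * (v ⬝ᵥ φ 0) := by
  have hd : ∀ t : ℝ, HasDerivAt (fun t : ℝ => Complex.exp (-(Complex.I * x * t)) * (v ⬝ᵥ φ t)) 0 t := by
    intro t
    have h1 := hφ.hasDerivAt_dotProduct v t
    rw [Matrix.dotProduct_mulVec, hv, smul_dotProduct, smul_eq_mul] at h1
    have h2 : HasDerivAt (fun t : ℝ => -(Complex.I * x * (t : ℂ))) (-(Complex.I * x * 1)) t :=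
      ((Complex.ofRealCLM.hasDerivAt (x := t)).const_mul (Complex.I * x)).neg
    refine (h2.cexp.mul h1).congr_deriv ?_
    ring
  have h := is_const_of_deriv_eq_zero (fun t => (hd t).differentiableAt) (fun t => (hd t).deriv) t 0
  simp only [Complex.ofReal_zero, mul_zero, neg_zero, Complex.exp_zero, one_mul] at h
  rw [← h, ← mul_assoc, ← Complex.exp_add, add_neg_cancel, Complex.exp_zero, one_mul]

/-- Matrices commuting with a symmetric Hamiltonian are conserved quantities. -/
theorem IsSchrodingerSolution.conserved (hφ : IsSchrodingerSolution H φ) (hH : H.IsSymm)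
    {B : Matrix V V ℂ} (hB : Commute B (H.map Complex.ofReal)) (t : ℝ) :
    star (φ t) ⬝ᵥ B.mulVec (φ t) = star (φ 0) ⬝ᵥ B.mulVec (φ 0) := by
  have hHc : (H.map Complex.ofReal).conjTranspose = H.map Complex.ofReal := by
    ext i j
    simp [Matrix.conjTranspose_apply, hH.apply i j]
  have hd : ∀ t : ℝ, HasDerivAt (fun t => star (φ t) ⬝ᵥ B.mulVec (φ t)) 0 t := by
    intro t
    have h1 := hasDerivAt_pi.1 (hφ t)
    have h2 : ∀ i, HasDerivAt (fun t => B.mulVec (φ t) i)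
        (B.mulVec (Complex.I • Matrix.mulVec (H.map Complex.ofReal) (φ t)) i) t := fun i =>
      HasDerivAt.fun_sum fun j _ => (h1 j).const_mul (B i j)
    have h3 : HasDerivAt (fun t => star (φ t) ⬝ᵥ B.mulVec (φ t)) _ t :=
      HasDerivAt.fun_sum fun i _ => (h1 i).star.mul (h2 i)
    refine h3.congr_deriv ?_
    rw [Finset.sum_add_distrib]
    change star (Complex.I • Matrix.mulVec (H.map Complex.ofReal) (φ t)) ⬝ᵥ B.mulVec (φ t) +
      star (φ t) ⬝ᵥ B.mulVec (Complex.I • Matrix.mulVec (H.map Complex.ofReal) (φ t)) = 0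
    rw [star_smul, Matrix.star_mulVec, hHc, smul_dotProduct, ← Matrix.dotProduct_mulVec,
      Matrix.mulVec_smul, dotProduct_smul, Matrix.mulVec_mulVec, Matrix.mulVec_mulVec, hB.eq]
    simp
  exact is_const_of_deriv_eq_zero (fun t => (hd t).differentiableAt) (fun t => (hd t).deriv) t 0

/-- Perfect state transfer is symmetric, by time translation. -/
theorem PerfectStateTransfer.symm [DecidableEq V] {u v : V} (h : PerfectStateTransfer H u v) :
    PerfectStateTransfer H v u := by
  obtain ⟨T, φ, hφ, h0, hn, hz⟩ := h
  have hγ : φ T v ≠ 0 := norm_ne_zero_iff.1 (by rw [hn]; exact one_ne_zero)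
  -- Dividing by the phase `φ T v` makes the translated solution start at exactly the indicator of
  -- `v`.
  refine ⟨-T, fun t => (φ T v)⁻¹ • φ (t + T), fun t => ?_, ?_, ?_, ?_⟩
  · rw [Matrix.mulVec_smul, smul_comm]
    exact HasDerivAt.const_smul (φ T v)⁻¹ ((hφ (t + T)).comp_add_const t T)
  · ext x
    by_cases hx : x = v
    · subst hx; simp [hγ]
    · simp [hx, hz x hx]
  · simp [h0, hn]
  · intro x hx
    simp [h0, hx]

end Schrodinger

/-! ### The path Hamiltonian and mirror symmetry of its potential -/

namespace PathHamiltonian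

variable {N : ℕ} (Q : Fin N → ℝ)

/-- The Hamiltonian of the path, as a complex matrix. -/
noncomputable def mat : Matrix (Fin N) (Fin N) ℂ :=
  (hamiltonian (SimpleGraph.pathGraph N) Q).map Complex.ofReal

/-- The diagonal of the Hamiltonian of the path, indexed from `1`. -/
noncomputable def diag (k : ℕ) : ℂ :=
  if h : k - 1 < N then -(Q ⟨k - 1, h⟩ : ℂ) else 0

/-- The indicator vector of the `k`-th vertex, indexed from `1`. -/
def vertex (N k : ℕ) : Fin N → ℂ := fun i => if (i : ℕ) + 1 = k then 1 else 0

theorem isSymm : (hamiltonian (SimpleGraph.pathGraph N) Q).IsSymm := by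
  classical
  exact (SimpleGraph.isSymm_adjMatrix _).sub (Matrix.isSymm_diagonal _)

theorem isSymm_mat : (mat Q).IsSymm := (isSymm Q).map _

theorem sum_succ_eq {w : ℕ → ℂ} (h0 : w 0 = 0) (i : Fin N) :
    ∑ j : Fin N, (if (j : ℕ) + 1 = i then w (j + 1) else 0) = w i := by
  rcases Nat.eq_zero_or_pos (i : ℕ) with h | h
  · rw [h, h0]; simp
  · rw [Finset.sum_eq_single ⟨i - 1, by omega⟩]
    · simp [Nat.sub_add_cancel h]
    · intro j _ hj
      rw [if_neg]
      intro hji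
      exact hj (Fin.ext (by simp; omega))
    · simp

theorem sum_pred_eq {w : ℕ → ℂ} (hN : w (N + 1) = 0) (i : Fin N) :
    ∑ j : Fin N, (if (i : ℕ) + 1 = j then w (j + 1) else 0) = w (i + 2) := by
  rcases Nat.lt_or_ge ((i : ℕ) + 1) N with h | h
  · rw [Finset.sum_eq_single ⟨i + 1, h⟩]
    · simp
    · intro j _ hj
      rw [if_neg]
      intro hji
      exact hj (Fin.ext (by simp; omega))
    · simp
  · have : (i : ℕ) + 2 = N + 1 := by omega
    rw [this, hN]
    exact Finset.sum_eq_zero fun j _ => if_neg (by omega)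

/-- The zero values at the fictitious vertices 0 and N + 1 let one three-term formula cover the
endpoints. -/
theorem mulVec_eq {w : ℕ → ℂ} (h0 : w 0 = 0) (hN : w (N + 1) = 0) :
    (mat Q).mulVec (fun i => w (i + 1)) =
      fun i : Fin N => w i + w (i + 2) + diag Q (i + 1) * w (i + 1) := by
  ext i
  have hentry : ∀ j : Fin N, mat Q i j * w (j + 1) =
      (if (j : ℕ) + 1 = i then w (j + 1) else 0) + (if (i : ℕ) + 1 = j then w (j + 1) else 0) +
      (if i = j then -(Q i : ℂ) * w (j + 1) else 0) := by
    intro j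
    have hadj : (SimpleGraph.pathGraph N).Adj i j ↔ (i : ℕ) + 1 = j ∨ (j : ℕ) + 1 = i :=
      SimpleGraph.pathGraph_adj
    simp only [mat, hamiltonian, Matrix.map_apply, Matrix.sub_apply, SimpleGraph.adjMatrix_apply,
      Matrix.diagonal_apply, hadj]
    split_ifs <;> first | omega | (push_cast; ring)
  change ∑ j, mat Q i j * w (j + 1) = _
  simp only [hentry, Finset.sum_add_distrib, sum_succ_eq h0, sum_pred_eq hN]
  simp [diag]

/-- Includes the endpoints because `vertex N 0` and `vertex N (N + 1)` are zero. -/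
theorem mulVec_vertex {k : ℕ} (h1 : 1 ≤ k) (hk : k ≤ N) : (mat Q).mulVec (vertex N k) =
    vertex N (k - 1) + vertex N (k + 1) + diag Q k • vertex N k := by
  have := mulVec_eq Q (w := fun j => if j = k then (1 : ℂ) else 0) (if_neg (by omega))
    (if_neg (by omega))
  refine Eq.trans this ?_
  ext i
  simp only [vertex, Pi.add_apply, Pi.smul_apply, smul_eq_mul]
  have e1 : ((i : ℕ) = k) ↔ ((i : ℕ) + 1 = k + 1) := by omega
  have e2 : ((i : ℕ) + 2 = k) ↔ ((i : ℕ) + 1 = k - 1) := by omega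
  simp only [e1, e2]
  by_cases h : (i : ℕ) + 1 = k
  · rw [h]; ring
  · simp [h]; ring

theorem vertex_dotProduct {k : ℕ} (hk : k < N) (w : Fin N → ℂ) :
    vertex N (k + 1) ⬝ᵥ w = w ⟨k, hk⟩ := by
  rw [dotProduct, Finset.sum_eq_single ⟨k, hk⟩]
  · simp [vertex]
  · intro j _ hj
    have : (j : ℕ) ≠ k := fun h => hj (Fin.ext h)
    simp [vertex, this]
  · simp

theorem aeval_mulVec (d : ℕ → ℂ) (M : Matrix (Fin N) (Fin N) ℂ) (k : ℕ) (w : Fin N → ℂ) :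
    (aeval M (jacobiPoly d (k + 2))).mulVec w = M.mulVec ((aeval M (jacobiPoly d (k + 1))).mulVec w) -
      d (k + 1) • (aeval M (jacobiPoly d (k + 1))).mulVec w -
      (aeval M (jacobiPoly d k)).mulVec w := by
  rw [jacobiPoly.rec_eq, map_sub, map_mul, map_sub, aeval_X, aeval_C,
    Algebra.algebraMap_eq_smul_one, Matrix.sub_mulVec, ← Matrix.mulVec_mulVec, Matrix.sub_mulVec,
    Matrix.smul_mulVec, Matrix.one_mulVec]

theorem aeval_mulVec_first {k : ℕ} (hk : k ≤ N + 1) :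
    (aeval (mat Q) (jacobiPoly (diag Q) k)).mulVec (vertex N 1) = vertex N k := by
  induction k using Nat.twoStepInduction with
  | zero => ext i; simp [jacobiPoly, vertex]
  | one => simp [jacobiPoly]
  | more k ih1 ih2 =>
    rw [aeval_mulVec, ih1 (by omega), ih2 (by omega), mulVec_vertex Q (by omega) (by omega),
      Nat.add_sub_cancel]
    abel

/-- From the far end the same polynomials walk backwards as long as the diagonal is mirrored.
Symmetry is required only below `k`, which lets `diag_mirror` apply this inside its own induction.
-/
theorem aeval_mulVec_last {k : ℕ} (hk : k ≤ N + 1)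
    (hd : ∀ j, 1 ≤ j → j < k → diag Q (N + 1 - j) = diag Q j) :
    (aeval (mat Q) (jacobiPoly (diag Q) k)).mulVec (vertex N N) = vertex N (N + 1 - k) := by
  induction k using Nat.twoStepInduction with
  | zero =>
    ext i
    have := i.2.ne
    simp [jacobiPoly, vertex, this]
  | one => simp [jacobiPoly]
  | more k ih1 ih2 =>
    rw [aeval_mulVec, ih1 (by omega) fun j h h' => hd j h (by omega),
      ih2 (by omega) fun j h h' => hd j h (by omega), mulVec_vertex Q (by omega) (by omega),
      hd (k + 1) (by omega) (by omega), show N + 1 - (k + 1) - 1 = N + 1 - (k + 2) by omega,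
      show N + 1 - (k + 1) + 1 = N + 1 - k by omega]
    abel

theorem vertex_mat_vertex {k : ℕ} (h1 : 1 ≤ k) (hk : k ≤ N) :
    vertex N k ⬝ᵥ (mat Q).mulVec (vertex N k) = diag Q k := by
  obtain ⟨k, rfl⟩ : ∃ l, k = l + 1 := ⟨k - 1, by omega⟩
  rw [vertex_dotProduct (by omega), mulVec_vertex Q h1 hk]
  simp [vertex]

theorem star_vertex (k : ℕ) : star (vertex N k) = vertex N k := by
  ext i
  simp only [vertex, Pi.star_apply]
  split_ifs <;> simp

theorem aeval_isSymm (p : ℂ[X]) : (aeval (mat Q) p).IsSymm := by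
  induction p using Polynomial.induction_on' with
  | add p q hp hq => rw [map_add]; exact hp.add hq
  | monomial n a =>
    rw [aeval_monomial, Algebra.algebraMap_eq_smul_one, smul_mul_assoc, one_mul]
    exact ((isSymm_mat Q).pow n).smul a

/-- Perfect state transfer between the ends forces the potential to be symmetric. -/
theorem diag_mirror {φ : ℝ → Fin N → ℂ}
    (hφ : IsSchrodingerSolution (hamiltonian (SimpleGraph.pathGraph N) Q) φ) {T : ℝ} {γ : ℂ}
    (hγ : ‖γ‖ = 1) (h0 : φ 0 = vertex N 1) (hT : φ T = γ • vertex N N) :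
    ∀ k, 1 ≤ k → k < N + 1 → diag Q (N + 1 - k) = diag Q k := by
  intro k
  induction k using Nat.strong_induction_on with
  | _ k ih =>
    intro h1 hk
    -- `P * mat Q * P` is a polynomial in H, hence conserved. Its expectation is `diag Q k` at the
    -- first vertex and `diag Q (N + 1 - k)` at the last.
    set P := aeval (mat Q) (jacobiPoly (diag Q) k)
    have hP : P.IsSymm := aeval_isSymm Q _
    have hB : P * mat Q * P = aeval (mat Q)
        (jacobiPoly (diag Q) k * X * jacobiPoly (diag Q) k) := by
      simp [P]
    have hcomm : Commute (P * mat Q * P) (mat Q) := by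
      rw [hB]
      nth_rw 2 [← aeval_X (R := ℂ) (mat Q)]
      rw [Commute, SemiconjBy, ← map_mul, ← map_mul, mul_comm]
    have hform : ∀ w : Fin N → ℂ, w ⬝ᵥ (P * mat Q * P).mulVec w =
        P.mulVec w ⬝ᵥ (mat Q).mulVec (P.mulVec w) := by
      intro w
      rw [← Matrix.mulVec_mulVec, ← Matrix.mulVec_mulVec, Matrix.dotProduct_mulVec,
        ← Matrix.mulVec_transpose, hP.eq]
    have h := hφ.conserved (isSymm Q) hcomm T
    have hγ' : star γ * γ = 1 := by
      rw [Complex.star_def, ← Complex.normSq_eq_conj_mul_self, Complex.normSq_eq_norm_sq, hγ]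
      norm_num
    rw [h0, hT, star_smul, smul_dotProduct, Matrix.mulVec_smul, dotProduct_smul, smul_smul, hγ',
      one_smul, star_vertex, star_vertex, hform, hform, aeval_mulVec_first Q hk.le,
      aeval_mulVec_last Q hk.le fun j h h' => ih j h' h (by omega),
      vertex_mat_vertex Q (by omega) (by omega), vertex_mat_vertex Q h1 (by omega)] at h
    exact h

/-! ### Eigenvalue phases and the contradiction -/

/-- Phases of the eigenvalues of the Hamiltonian under perfect state transfer. -/
theorem exp_eigenvalue {φ : ℝ → Fin N → ℂ}
    (hφ : IsSchrodingerSolution (hamiltonian (SimpleGraph.pathGraph N) Q) φ) {T : ℝ} {γ : ℂ}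
    (hN : 1 ≤ N) (h0 : φ 0 = vertex N 1) (hT : φ T = γ • vertex N N) {x ε : ℂ}
    (hx : (jacobiPoly (diag Q) (N + 1)).eval x = 0) (hε : (jacobiPoly (diag Q) N).eval x = ε) :
    Complex.exp (Complex.I * x * T) = γ * ε := by
  -- The eigenvector for `x`: its first entry is 1 and its last is `ε`.
  set v : Fin N → ℂ := fun i => (jacobiPoly (diag Q) (i + 1)).eval x
  have hv : Matrix.vecMul v (mat Q) = x • v := by
    rw [← Matrix.mulVec_transpose, (isSymm_mat Q).eq]
    refine (mulVec_eq Q (w := fun k => (jacobiPoly (diag Q) k).eval x) (by simp [jacobiPoly]) hx).trans ?_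
    ext i
    simp [v, jacobiPoly.rec_eq]
    ring
  have h := hφ.dotProduct_eigenvector hv T
  obtain ⟨n, rfl⟩ : ∃ n, N = n + 1 := ⟨N - 1, by omega⟩
  rw [h0, hT, dotProduct_smul, dotProduct_comm, dotProduct_comm v (vertex _ 1),
    vertex_dotProduct (by omega), vertex_dotProduct (k := 0) (by omega)] at h
  simp only [v, hε, smul_eq_mul] at h
  simp [jacobiPoly] at h
  exact h.symm

/-- Eigenvalues with the same phase up to sign differ by integral multiples of `π / T`. -/
theorem exists_even_lattice {T : ℝ} (hT : T ≠ 0) {x ω : ℂ}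
    (h : Complex.exp (Complex.I * x * T) = Complex.exp (Complex.I * ω * T)) :
    ∃ k : ℤ, ω + (Real.pi / T : ℂ) * ((2 * k : ℤ) : ℂ) = x := by
  obtain ⟨n, hn⟩ := Complex.exp_eq_exp_iff_exists_int.1 h
  refine ⟨n, ?_⟩
  have hT' : (T : ℂ) ≠ 0 := Complex.ofReal_ne_zero.2 hT
  field_simp
  push_cast
  linear_combination Complex.I * hn - (x * T - ω * T - 2 * Real.pi * n) * Complex.I_sq

theorem exists_odd_lattice {T : ℝ} (hT : T ≠ 0) {x ω : ℂ}
    (h : Complex.exp (Complex.I * x * T) = -Complex.exp (Complex.I * ω * T)) :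
    ∃ k : ℤ, ω + (Real.pi / T : ℂ) * ((2 * k + 1 : ℤ) : ℂ) = x := by
  have hT' : (T : ℂ) ≠ 0 := Complex.ofReal_ne_zero.2 hT
  -- Shifting `ω` by π/T absorbs the sign.
  obtain ⟨k, hk⟩ := exists_even_lattice hT (x := x) (ω := ω + Real.pi / T) (by
    rw [h, ← Complex.exp_add_pi_mul_I]
    congr 1
    field_simp)
  refine ⟨k, ?_⟩
  rw [← hk]
  push_cast
  ring

theorem not_perfectStateTransfer (hN : 4 ≤ N) {φ : ℝ → Fin N → ℂ}
    (hφ : IsSchrodingerSolution (hamiltonian (SimpleGraph.pathGraph N) Q) φ) {T : ℝ} (hT0 : T ≠ 0)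
    {γ : ℂ} (hγ : ‖γ‖ = 1) (h0 : φ 0 = vertex N 1) (hT : φ T = γ • vertex N N) : False := by
  have hd := diag_mirror Q hφ hγ h0 hT
  have hγ0 : γ ≠ 0 := norm_ne_zero_iff.1 (by rw [hγ]; exact one_ne_zero)
  -- With the phase -γ as origin, the antisymmetric eigenvalues (ε = -1) take the even lattice
  -- points and the symmetric ones the odd points.
  obtain ⟨ω, hω⟩ : ∃ ω : ℂ, Complex.exp (Complex.I * ω * T) = -γ := by
    have hT' : (T : ℂ) ≠ 0 := Complex.ofReal_ne_zero.2 hT0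
    refine ⟨Complex.log (-γ) / (Complex.I * T), ?_⟩
    rw [show Complex.I * (Complex.log (-γ) / (Complex.I * T)) * T = Complex.log (-γ) by field_simp,
      Complex.exp_log (neg_ne_zero.2 hγ0)]
  have hodd : ∀ {m : ℕ} {x : ℂ}, m + 1 ≤ N + 1 → 1 ≤ m →
      (jacobiPoly (diag Q) (N + 1 - m)).eval x = 1 * (jacobiPoly (diag Q) m).eval x →
      (jacobiPoly (diag Q) (N + 1 - (m + 1))).eval x = 1 * (jacobiPoly (diag Q) (m + 1)).eval x →
      ∃ k : ℤ, ω + (Real.pi / T : ℂ) * ((2 * k + 1 : ℤ) : ℂ) = x := by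
    intro m x hm h1 e1 e2
    obtain ⟨h2, h3⟩ := jacobiPoly.eval_mirror (diag Q) hd x 1 hm e1 e2
    refine exists_odd_lattice hT0 ?_
    rw [exp_eigenvalue Q hφ (by omega) h0 hT h2 (h3 h1), hω]
    ring
  have heven : ∀ {m : ℕ} {x : ℂ}, m + 1 ≤ N + 1 → 1 ≤ m →
      (jacobiPoly (diag Q) (N + 1 - m)).eval x = -1 * (jacobiPoly (diag Q) m).eval x →
      (jacobiPoly (diag Q) (N + 1 - (m + 1))).eval x = -1 * (jacobiPoly (diag Q) (m + 1)).eval x →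
      ∃ k : ℤ, ω + (Real.pi / T : ℂ) * ((2 * k : ℤ) : ℂ) = x := by
    intro m x hm h1 e1 e2
    obtain ⟨h2, h3⟩ := jacobiPoly.eval_mirror (diag Q) hd x (-1) hm e1 e2
    refine exists_even_lattice hT0 ?_
    rw [exp_eigenvalue Q hφ (by omega) h0 hT h2 (h3 h1), hω]
    ring
  rcases Nat.even_or_odd' N with ⟨m, hm | hm⟩
  · obtain ⟨n, rfl⟩ : ∃ n, m = n + 1 := ⟨m - 1, by omega⟩
    have s1 : N + 1 - (n + 1) = n + 2 := by omega
    have s2 : N + 1 - (n + 1 + 1) = n + 1 := by omega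
    obtain ⟨hcp, hcq, hsum, hprod⟩ := jacobiPoly.even_factors (diag Q) n rfl rfl
    obtain ⟨A, hA⟩ := Multiset.exists_map_eq
      (s := (jacobiPoly (diag Q) (n + 2) - jacobiPoly (diag Q) (n + 1)).roots) fun x hx => by
        have := (mem_roots'.1 hx).2
        rw [IsRoot.def, eval_sub] at this
        refine hodd (m := n + 1) (by omega) (by omega) ?_ ?_
        · rw [s1]; linear_combination this
        · rw [s2]; linear_combination -this
    obtain ⟨B, hB⟩ := Multiset.exists_map_eq
      (s := (jacobiPoly (diag Q) (n + 2) + jacobiPoly (diag Q) (n + 1)).roots) fun x hx => by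
        have := (mem_roots'.1 hx).2
        rw [IsRoot.def, eval_add] at this
        refine heven (m := n + 1) (by omega) (by omega) ?_ ?_
        · rw [s1]; linear_combination this
        · rw [s2]; linear_combination this
    rw [← hA] at hcp hsum hprod
    rw [← hB] at hcq hsum hprod
    rw [Multiset.card_map] at hcp hcq
    exact even_spectrum_false (by omega) hcp hcq hsum hprod
  · obtain ⟨n, rfl⟩ : ∃ n, m = n + 2 := ⟨m - 2, by omega⟩
    have s1 : N + 1 - (n + 2) = n + 4 := by omega
    have s2 : N + 1 - (n + 2 + 1) = n + 3 := by omega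
    obtain ⟨hcp, hcq, hsum, hprod⟩ := jacobiPoly.odd_factors (diag Q) n rfl rfl
    obtain ⟨A, hA⟩ := Multiset.exists_map_eq
      (s := (jacobiPoly (diag Q) (n + 4) - jacobiPoly (diag Q) (n + 2)).roots) fun x hx => by
        have := (mem_roots'.1 hx).2
        rw [IsRoot.def, eval_sub] at this
        refine hodd (m := n + 2) (by omega) (by omega) ?_ ?_
        · rw [s1]; linear_combination this
        · rw [s2, one_mul]
    obtain ⟨B, hB⟩ := Multiset.exists_map_eq
      (s := (jacobiPoly (diag Q) (n + 3)).roots) fun x hx => by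
        have := (mem_roots'.1 hx).2
        rw [IsRoot.def] at this
        -- The eigenvector vanishes at the middle vertex n + 3, so the recurrence there makes its
        -- two neighbours opposite.
        refine heven (m := n + 2) (by omega) (by omega) ?_ ?_
        · rw [s1, jacobiPoly.rec_eq, eval_sub, eval_mul, this]
          ring
        · rw [s2, this, mul_zero]
    rw [← hB] at hcp hsum hprod
    rw [← hA] at hcq hsum hprod
    rw [Multiset.card_map] at hcp hcq
    exact odd_spectrum_false (by omega) hcq hcp hsum hprod

end PathHamiltonian

theorem theorem1 (N : ℕ) (hN : 4 ≤ N) (Q : Fin N → ℝ) :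
    ¬ PerfectStateTransfer (hamiltonian (SimpleGraph.pathGraph N) Q)
        (⟨0, by omega⟩ : Fin N) (⟨N - 1, by omega⟩ : Fin N) ∧
    ¬ PerfectStateTransfer (hamiltonian (SimpleGraph.pathGraph N) Q)
        (⟨N - 1, by omega⟩ : Fin N) (⟨0, by omega⟩ : Fin N) := by
  have main : ¬ PerfectStateTransfer (hamiltonian (SimpleGraph.pathGraph N) Q)
      (⟨0, by omega⟩ : Fin N) (⟨N - 1, by omega⟩ : Fin N) := by
    rintro ⟨T, φ, hφ, h0, hn, hz⟩
    refine PathHamiltonian.not_perfectStateTransfer Q hN hφ (T := T) ?_ hn ?_ ?_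
    · rintro rfl
      rw [h0, Pi.single_eq_of_ne (by simp; omega)] at hn
      simp at hn
    · ext i
      rw [h0, Pi.single_apply]
      simp [PathHamiltonian.vertex, Fin.ext_iff]
    · ext i
      by_cases hi : i = ⟨N - 1, by omega⟩
      · subst hi
        simp [PathHamiltonian.vertex, show N - 1 + 1 = N by omega]
      · have : (i : ℕ) + 1 ≠ N := fun h => hi (Fin.ext (by simp; omega))
        rw [hz i hi]
        simp [PathHamiltonian.vertex, this]
  exact ⟨main, fun h => main h.symm⟩
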